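/- For a linearly ordered set $C$, the interval algebra $B(C)$ is the Boolean subalgebra of the power set $\mathcal{P}(C)$ generated by the intervals $[a,\rightarrow)=\{x\in C : x\ge a\}$, $a\in C$. An interval Boolean algebra is a Boolean algebra isomorphic to $B(C)$ for some linearly ordered set $C$. For a Boolean algebra $B$, let $\mathrm{Ult}(B)$ be the set of ultrafilters of $B$ with the Stone topology, generated by the sets $\{p\in\mathrm{Ult}(B) : a\in p\}$, $a\in B$. Theorem. Let $B$ be an interval Boolean algebra and let $\lambda$ be an infinite cardinal such that $|B|>\lambda^{+}$. Then for every set $G\subseteq B$ that generates $B$ as a Boolean algebra and every topologically dense set $D\subseteq \mathrm{Ult}(B)$ there exists $p\in D$ such that $|G\cap p|>\lambda$. -/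

import Mathlib

universe u

/-- The interval algebra of a chain `C`: the subalgebra of the power set of `C` generated by the
final intervals `[a, →) = {x | a ≤ x}`, `a ∈ C`. -/
def intervalAlgebra (C : Type u) [LinearOrder C] : BooleanSubalgebra (Set C) :=
  BooleanSubalgebra.closure (Set.range fun a : C => Set.Ici a)

/-- `B` is an interval Boolean algebra: it is isomorphic to the interval algebra of some chain.
(An order isomorphism between Boolean algebras is the same as a Boolean isomorphism.) -/
def IsIntervalBooleanAlgebra (B : Type u) [BooleanAlgebra B] : Prop :=
  ∃ (C : Type u) (_ : LinearOrder C), Nonempty (B ≃o intervalAlgebra C)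

/-- An ultrafilter of a Boolean algebra `B`: a proper filter which contains `a` or `aᶜ` for
every `a : B`. -/
structure Ult (B : Type u) [BooleanAlgebra B] extends Order.PFilter B where
  bot_notMem : ⊥ ∉ toPFilter
  mem_or_compl_mem : ∀ a : B, a ∈ toPFilter ∨ aᶜ ∈ toPFilter

/-- The Stone topology on the set of ultrafilters, generated by the sets `{p | a ∈ p}`. -/
instance Ult.instTopologicalSpace (B : Type u) [BooleanAlgebra B] : TopologicalSpace (Ult B) :=
  TopologicalSpace.generateFrom (Set.range fun a : B => {p : Ult B | a ∈ p.toPFilter})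

open Cardinal BooleanSubalgebra

/-! ### Ultrafilters of a Boolean algebra: traces on generators, limits, compactness. -/

namespace Ult

variable {B : Type u} [BooleanAlgebra B]

/-! Suppose every ultrafilter in `D` is small, that is, contains at most λ members of `G`. Small
ultrafilters are then dense, and it suffices to deduce |B| ≤ λ⁺. Fix a chain `C` containing both
bounds and generating `B`.

An ultrafilter supported on `A ⊆ C` is rigid: any ultrafilter with the same trace on `A` contains
all its members of `G`, and two supported ones with the same trace on `A` coincide
(`SupportedOn.eq_of_agree`). Density of small ultrafilters lets any `A` be enlarged cheaply to a
saturated set (`exists_isSaturated`). By compactness every element of `C` outside a saturated `A`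
lies in the gap of a supported ultrafilter, and at most κ such gaps are nonempty when |A| ≤ κ and κ
is infinite (`mk_filledCuts_le`).

If |B| > λ⁺ then |C| > λ⁺. A closure argument of length λ⁺ gives a saturated `A₀` of size at most λ⁺
whose nonempty gaps all belong to ultrafilters that are not small, and counting gives one, `q₀`,
whose gap has more than λ⁺ elements. Splitting large gaps repeatedly yields successive distinct
ultrafilters `qₙ` with increasing traces on `G`. By Ramsey a subsequence is monotone in the order of
cuts. Small ultrafilters can be interleaved with it, so its limit is small; but the limit contains
`G ∩ q₀`, a contradiction. -/

theorem mem_of_le (p : Ult B) {a b : B} (h : a ≤ b) (ha : a ∈ p.toPFilter) : b ∈ p.toPFilter :=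
  Order.PFilter.mem_of_le h ha

theorem top_mem (p : Ult B) : ⊤ ∈ p.toPFilter :=
  Order.PFilter.top_mem

theorem inf_mem (p : Ult B) {a b : B} (ha : a ∈ p.toPFilter) (hb : b ∈ p.toPFilter) :
    a ⊓ b ∈ p.toPFilter :=
  Order.PFilter.inf_mem ha hb

theorem compl_mem_iff (p : Ult B) {a : B} : aᶜ ∈ p.toPFilter ↔ a ∉ p.toPFilter := by
  refine ⟨fun h h' => p.bot_notMem ?_, fun h => (p.mem_or_compl_mem a).resolve_left h⟩
  simpa using p.inf_mem h' h

theorem sup_mem_iff (p : Ult B) {a b : B} :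
    a ⊔ b ∈ p.toPFilter ↔ a ∈ p.toPFilter ∨ b ∈ p.toPFilter := by
  refine ⟨fun h => ?_, fun h => h.elim (p.mem_of_le le_sup_left) (p.mem_of_le le_sup_right)⟩
  by_contra! hn
  have h' := p.inf_mem (p.inf_mem (p.compl_mem_iff.2 hn.1) (p.compl_mem_iff.2 hn.2)) h
  rw [← compl_sup, compl_inf_eq_bot] at h'
  exact p.bot_notMem h'

theorem ext_mem {p q : Ult B} (h : ∀ b, b ∈ p.toPFilter ↔ b ∈ q.toPFilter) : p = q := by
  have : p.toPFilter = q.toPFilter := Order.PFilter.ext _ _ (Set.ext h)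
  cases p; cases q; congr

/-- Two ultrafilters that agree on a set agree on the subalgebra it generates. -/
theorem mem_iff_of_mem_closure {p q : Ult B} {S : Set B}
    (h : ∀ b ∈ S, b ∈ p.toPFilter ↔ b ∈ q.toPFilter) {b : B} (hb : b ∈ closure S) :
    b ∈ p.toPFilter ↔ b ∈ q.toPFilter := by
  induction hb using closure_bot_sup_induction with
  | mem x hx => exact h x hx
  | bot => simp [p.bot_notMem, q.bot_notMem]
  | sup x hx y hy ihx ihy => rw [sup_mem_iff, sup_mem_iff, ihx, ihy]
  | compl x hx ih => rw [compl_mem_iff, compl_mem_iff, ih]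

theorem eq_of_closure_eq_top {p q : Ult B} {S : Set B} (hS : closure S = ⊤)
    (h : ∀ b ∈ S, b ∈ p.toPFilter ↔ b ∈ q.toPFilter) : p = q :=
  ext_mem fun b => mem_iff_of_mem_closure h (by simp [hS])

/-- The limit of a family of ultrafilters of `B` along an ultrafilter on the index set. -/
def lim {ι : Type*} (F : Ultrafilter ι) (P : ι → Ult B) : Ult B where
  toPFilter := Order.IsPFilter.toPFilter (F := {b | ∀ᶠ i in (F : Filter ι), b ∈ (P i).toPFilter})
    (.of_def ⟨⊤, .of_forall fun i => (P i).top_mem⟩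
      (fun a ha b hb => ⟨a ⊓ b, (Filter.Eventually.and ha hb).mono
        fun i hi => (P i).inf_mem hi.1 hi.2, inf_le_left, inf_le_right⟩)
      fun hab ha => Filter.Eventually.mono ha fun i hi => (P i).mem_of_le hab hi)
  bot_notMem h := by
    obtain ⟨i, hi⟩ := Filter.Eventually.exists (f := (F : Filter ι)) h
    exact (P i).bot_notMem hi
  mem_or_compl_mem a := by
    have := F.em fun i => a ∈ (P i).toPFilter
    simp_rw [← compl_mem_iff] at this
    exact this

theorem mem_lim {ι : Type*} {F : Ultrafilter ι} {P : ι → Ult B} {b : B} :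
    b ∈ (lim F P).toPFilter ↔ ∀ᶠ i in (F : Filter ι), b ∈ (P i).toPFilter :=
  Iff.rfl

/-- Compactness of the Stone space. -/
theorem exists_of_finite (U V : Set B)
    (h : ∀ s : Finset B, ∃ p : Ult B, (∀ u ∈ s, u ∈ U → u ∈ p.toPFilter) ∧
      ∀ v ∈ s, v ∈ V → v ∉ p.toPFilter) :
    ∃ p : Ult B, (∀ u ∈ U, u ∈ p.toPFilter) ∧ ∀ v ∈ V, v ∉ p.toPFilter := by
  classical
  choose P hPU hPV using h
  -- Refining `atTop` makes each fixed element of `B` belong to `F`-almost every finite set.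
  let F : Ultrafilter (Finset B) := .of .atTop
  have hF (b : B) : ∀ᶠ s in (F : Filter (Finset B)), b ∈ s :=
    Ultrafilter.of_le _ ((Filter.eventually_ge_atTop {b}).mono fun s hs => by simpa using hs)
  refine ⟨lim F P, fun u hu => (hF u).mono fun s hs => hPU s u hs hu, fun v hv hvp => ?_⟩
  obtain ⟨s, hs, hs'⟩ := ((hF v).and (mem_lim.1 hvp)).exists
  exact hPV s v hs hv hs'

theorem exists_mem_of_ne_bot {b : B} (hb : b ≠ ⊥) : ∃ p : Ult B, b ∈ p.toPFilter := by
  obtain ⟨J, hJ, -, hd⟩ := DistribLattice.prime_ideal_of_disjoint_filter_ideal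
    (F := Order.PFilter.principal b) (I := Order.Ideal.principal (⊥ : B)) (by
      rw [Set.disjoint_left]
      intro x hx hx'
      have h1 : b ≤ x := hx
      have h2 : x ≤ ⊥ := hx'
      exact hb (le_bot_iff.1 (h1.trans h2)))
  refine ⟨⟨hJ.compl_filter.toPFilter, fun h => h J.bot_mem, fun a => ?_⟩,
    fun h => Set.disjoint_left.1 hd (show b ∈ Order.PFilter.principal b from le_rfl) h⟩
  by_contra! hn
  have h1 : a ∈ J := not_not.1 hn.1
  have h2 : aᶜ ∈ J := not_not.1 hn.2
  refine hJ.top_notMem ?_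
  rw [← sup_compl_eq_top (x := a)]
  exact J.sup_mem h1 h2

end Ult

/-! ### Cardinality of unions, closures and generated subalgebras. -/

section Cardinality

theorem mk_iUnion_le_of_le {ι α : Type u} {κ : Cardinal.{u}} (hκ : ℵ₀ ≤ κ) (hι : #ι ≤ κ)
    {f : ι → Set α} (hf : ∀ i, #(f i) ≤ κ) : #(⋃ i, f i) ≤ κ :=
  calc #(⋃ i, f i) ≤ #ι * ⨆ i, #(f i) := mk_iUnion_le f
    _ ≤ κ * κ := mul_le_mul' hι (ciSup_le' hf)
    _ = κ := mul_eq_self hκ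

theorem mk_biUnion_le_of_le {ι α : Type u} {κ : Cardinal.{u}} (hκ : ℵ₀ ≤ κ) {s : Set ι}
    (hs : #s ≤ κ) {f : ι → Set α} (hf : ∀ i ∈ s, #(f i) ≤ κ) : #(⋃ i ∈ s, f i) ≤ κ := by
  rw [Set.biUnion_eq_iUnion]
  exact mk_iUnion_le_of_le hκ hs fun i => hf i i.2

theorem mk_union_le_of_le {α : Type u} {κ : Cardinal.{u}} (hκ : ℵ₀ ≤ κ) {s t : Set α}
    (hs : #s ≤ κ) (ht : #t ≤ κ) : #(s ∪ t : Set α) ≤ κ :=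
  (mk_union_le s t).trans (add_le_of_le hκ hs ht)

theorem mk_le_of_finite {α : Type u} {κ : Cardinal.{u}} (hκ : ℵ₀ ≤ κ) {s : Set α}
    (hs : s.Finite) : #s ≤ κ :=
  (Cardinal.lt_aleph0_iff_set_finite.2 hs).le.trans hκ

/-- Closing off a set under a binary set-valued operation. -/
theorem exists_superset_closed {α : Type u} {κ : Cardinal.{u}} (hκ : ℵ₀ ≤ κ)
    (Φ : α → α → Set α) (hΦ : ∀ a b, #(Φ a b) ≤ κ) {S : Set α} (hS : #S ≤ κ) :
    ∃ A : Set α, S ⊆ A ∧ #A ≤ κ ∧ ∀ a ∈ A, ∀ b ∈ A, Φ a b ⊆ A := by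
  let step : Set α → Set α := fun A => A ∪ ⋃ a ∈ A, ⋃ b ∈ A, Φ a b
  let A : ℕ → Set α := fun n => step^[n] S
  have hA (n : ℕ) : A (n + 1) = step (A n) := Function.iterate_succ_apply' _ _ _
  have hmono : Monotone A := monotone_nat_of_le_succ fun n => by
    rw [hA]; exact Set.subset_union_left
  have hcard (n : ℕ) : #(A n) ≤ κ := by
    induction n with
    | zero => exact hS
    | succ n ih =>
      rw [hA]
      exact mk_union_le_of_le hκ ih (mk_biUnion_le_of_le hκ ih fun a _ =>
        mk_biUnion_le_of_le hκ ih fun b _ => hΦ a b)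
  refine ⟨⋃ n : ULift.{u} ℕ, A n.down, fun x hx => Set.mem_iUnion.2 ⟨⟨0⟩, hx⟩,
    mk_iUnion_le_of_le hκ (by simpa using hκ) fun n => hcard _, fun a ha b hb x hx => ?_⟩
  obtain ⟨⟨m⟩, hm⟩ := Set.mem_iUnion.1 ha
  obtain ⟨⟨n⟩, hn⟩ := Set.mem_iUnion.1 hb
  refine Set.mem_iUnion.2 ⟨⟨max m n + 1⟩, ?_⟩
  change x ∈ A (max m n + 1)
  rw [hA]
  exact Or.inr (Set.mem_biUnion (hmono (le_max_left m n) hm)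
    (Set.mem_biUnion (hmono (le_max_right m n) hn) hx))

theorem mk_closure_le {B : Type u} [BooleanAlgebra B] {κ : Cardinal.{u}} (hκ : ℵ₀ ≤ κ)
    {S : Set B} (hS : #S ≤ κ) : #(closure S) ≤ κ := by
  obtain ⟨A, hSA, hA, hcl⟩ := exists_superset_closed hκ (fun a b : B => {⊥, aᶜ, a ⊔ b})
    (fun a b => mk_le_of_finite hκ (by simp)) (S := S ∪ {⊥})
    (mk_union_le_of_le hκ hS (mk_le_of_finite hκ (by simp)))
  refine (mk_le_mk_of_subset (t := A) fun x hx => ?_).trans hA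
  replace hx : x ∈ closure S := hx
  induction hx using closure_bot_sup_induction with
  | mem x hx => exact hSA (Or.inl hx)
  | bot => exact hSA (Or.inr rfl)
  | sup x hx y hy ihx ihy => exact hcl x ihx y ihy (by simp)
  | compl x hx ih => exact hcl x ih x ih (by simp)

end Cardinality

theorem exists_finset_mem_closure {B : Type u} [BooleanAlgebra B] {S : Set B} {b : B}
    (hb : b ∈ closure S) : ∃ t : Finset B, (t : Set B) ⊆ S ∧ b ∈ closure (t : Set B) := by
  classical
  induction hb using closure_bot_sup_induction with
  | mem x hx => exact ⟨{x}, by simpa using hx, subset_closure (by simp)⟩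
  | bot => exact ⟨∅, by simp, bot_mem⟩
  | sup x hx y hy ihx ihy =>
    obtain ⟨s, hs, hxs⟩ := ihx
    obtain ⟨t, ht, hyt⟩ := ihy
    refine ⟨s ∪ t, by simp [hs, ht], sup_mem ?_ ?_⟩
    · exact closure_mono (by simp) hxs
    · exact closure_mono (by simp) hyt
  | compl x hx ih =>
    obtain ⟨s, hs, hxs⟩ := ih
    exact ⟨s, hs, compl_mem hxs⟩

theorem exists_finset_lower_bound {B : Type u} [Preorder B] {U : Set B} (hU : IsChain (· ≤ ·) U)
    (hne : U.Nonempty) (s : Finset B) : ∃ u₀ ∈ U, ∀ u ∈ s, u ∈ U → u₀ ≤ u := by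
  classical
  induction s using Finset.induction_on with
  | empty => exact ⟨hne.some, hne.some_mem, by simp⟩
  | insert x s _ ih =>
    obtain ⟨u₀, hu₀, h⟩ := ih
    by_cases hx : x ∈ U
    · rcases hU.total hu₀ hx with h' | h'
      · exact ⟨u₀, hu₀, by grind⟩
      · refine ⟨x, hx, fun u hu huU => ?_⟩
        rcases Finset.mem_insert.1 hu with rfl | hu
        · exact le_rfl
        · exact h'.trans (h u hu huU)
    · exact ⟨u₀, hu₀, by grind⟩

theorem exists_finset_upper_bound {B : Type u} [Preorder B] {U : Set B} (hU : IsChain (· ≤ ·) U)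
    (hne : U.Nonempty) (s : Finset B) : ∃ u₀ ∈ U, ∀ u ∈ s, u ∈ U → u ≤ u₀ :=
  exists_finset_lower_bound (B := Bᵒᵈ) (U := U) (fun _ ha _ hb hab => (hU ha hb hab).symm) hne s

/-! ### Saturated subsets of the chain and their cuts. -/

section Chain

variable {B : Type u} [BooleanAlgebra B]

/-- All members of `G` lying in the ultrafilter `q` belong to the subalgebra generated by `A`. -/
def SupportedOn (G A : Set B) (q : Ult B) : Prop :=
  ∀ g ∈ G, g ∈ q.toPFilter → g ∈ closure A

/-- A part `A` of the chain `C` is saturated if every nonempty interval of `A` belongs to an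
ultrafilter supported on `A`; then the subalgebra generated by `A` is a retract of `B`. -/
structure IsSaturated (C G A : Set B) : Prop where
  subset : A ⊆ C
  bot_mem : ⊥ ∈ A
  top_mem : ⊤ ∈ A
  exists_supportedOn : ∀ a ∈ A, ∀ a' ∈ A, a < a' →
    ∃ p : Ult B, a ∉ p.toPFilter ∧ a' ∈ p.toPFilter ∧ SupportedOn G A p

/-- The elements of the chain `C` that lie strictly inside the cut of `A` given by `q`. -/
def gap (C A : Set B) (q : Ult B) : Set B :=
  {c ∈ C | ∀ a ∈ A, (a ∈ q.toPFilter → c < a) ∧ (a ∉ q.toPFilter → a < c)}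

/-- The ultrafilter `q` contains at most `lam` members of `G`. -/
def IsSmall (G : Set B) (lam : Cardinal.{u}) (q : Ult B) : Prop :=
  #↥(G ∩ (q.toPFilter : Set B)) ≤ lam

variable {C G A A' : Set B} {q q' : Ult B}

theorem IsChain.lt_of_not_le_of_mem (hC : IsChain (· ≤ ·) C) {a b : B} (ha : a ∈ C) (hb : b ∈ C)
    (h : ¬ a ≤ b) : b < a :=
  lt_of_le_not_ge ((hC.total ha hb).resolve_left h) h

theorem IsChain.lt_of_mem_of_notMem_ult (hC : IsChain (· ≤ ·) C) {a b : B} (ha : a ∈ C)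
    (hb : b ∈ C) (haq : a ∈ q.toPFilter) (hbq : b ∉ q.toPFilter) : b < a :=
  hC.lt_of_not_le_of_mem ha hb fun h => hbq (q.mem_of_le h haq)

theorem SupportedOn.mono (h : SupportedOn G A q) (hA : A ⊆ A') : SupportedOn G A' q :=
  fun g hg hgq => closure_mono hA (h g hg hgq)

/-- Only `q` need be supported, so the inclusion of traces on `G` goes one way; this asymmetry makes
the final sequence increase. -/
theorem SupportedOn.mem_of_agree (hq : SupportedOn G A q)
    (h : ∀ a ∈ A, a ∈ q.toPFilter ↔ a ∈ q'.toPFilter) {g : B} (hg : g ∈ G)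
    (hgq : g ∈ q.toPFilter) : g ∈ q'.toPFilter :=
  (Ult.mem_iff_of_mem_closure h (hq g hg hgq)).1 hgq

theorem SupportedOn.eq_of_agree (hG : closure G = ⊤) (hq : SupportedOn G A q)
    (hq' : SupportedOn G A q') (h : ∀ a ∈ A, a ∈ q.toPFilter ↔ a ∈ q'.toPFilter) : q = q' :=
  Ult.eq_of_closure_eq_top hG fun _ hg =>
    ⟨hq.mem_of_agree h hg, hq'.mem_of_agree (fun a ha => (h a ha).symm) hg⟩

theorem gap_anti (hA : A ⊆ A') : gap C A' q ⊆ gap C A q :=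
  fun _ hc => ⟨hc.1, fun a ha => hc.2 a (hA ha)⟩

theorem agree_of_mem_gap {c : B} (hA : A ⊆ A') (hc : c ∈ gap C A q) (hc' : c ∈ gap C A' q') :
    ∀ a ∈ A, a ∈ q.toPFilter ↔ a ∈ q'.toPFilter := by
  intro a ha
  have h1 := hc.2 a ha
  have h2 := hc'.2 a (hA ha)
  refine ⟨fun h => ?_, fun h => ?_⟩ <;> by_contra hn
  · exact lt_asymm (h1.1 h) (h2.2 hn)
  · exact lt_asymm (h1.2 hn) (h2.1 h)

/-- A cut of the chain that is approximated by intervals of a saturated set `A` is realized by an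
ultrafilter supported on `A`. -/
theorem IsSaturated.exists_of_cut (hA : IsSaturated C G A) {U V : Set B}
    (hU : IsChain (· ≤ ·) U) (hUne : U.Nonempty) (hV : IsChain (· ≤ ·) V) (hVne : V.Nonempty)
    (h : ∀ u ∈ U, ∀ v ∈ V, ∃ a ∈ A, ∃ a' ∈ A, a < a' ∧ v ≤ a ∧ a' ≤ u) :
    ∃ q : Ult B, SupportedOn G A q ∧ (∀ u ∈ U, u ∈ q.toPFilter) ∧ ∀ v ∈ V, v ∉ q.toPFilter := by
  -- Being supported on `A` means avoiding each `g ∈ G` outside `closure A`, so it joins the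
  -- conditions handled by compactness.
  obtain ⟨q, hqU, hqV⟩ := Ult.exists_of_finite U (V ∪ {g ∈ G | g ∉ closure A}) fun s => by
    obtain ⟨u, hu, hus⟩ := exists_finset_lower_bound hU hUne s
    obtain ⟨v, hv, hvs⟩ := exists_finset_upper_bound hV hVne s
    obtain ⟨a, ha, a', ha', hlt, hva, hau⟩ := h u hu v hv
    obtain ⟨p, hap, hap', hp⟩ := hA.exists_supportedOn a ha a' ha' hlt
    refine ⟨p, fun x hx hxU => p.mem_of_le (hau.trans (hus x hx hxU)) hap', ?_⟩
    rintro x hx (hxV | ⟨hxG, hxA⟩) hxp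
    · exact hap (p.mem_of_le ((hvs x hx hxV).trans hva) hxp)
    · exact hxA (hp x hxG hxp)
  refine ⟨q, fun g hg hgq => ?_, hqU, fun v hv => hqV v (Or.inl hv)⟩
  by_contra hn
  exact hqV g (Or.inr ⟨hg, hn⟩) hgq

theorem IsSaturated.exists_mem_gap (hC : IsChain (· ≤ ·) C) (hA : IsSaturated C G A) {c : B}
    (hc : c ∈ C) (hcA : c ∉ A) : ∃ q : Ult B, SupportedOn G A q ∧ c ∈ gap C A q := by
  have hne {a : B} (ha : a ∈ A) : a ≠ c := fun h => hcA (h ▸ ha)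
  obtain ⟨q, hq, hqU, hqV⟩ := hA.exists_of_cut (U := {a ∈ A | c < a}) (V := {a ∈ A | a < c})
    (hC.mono fun a ha => hA.subset ha.1) ⟨⊤, hA.top_mem, (hne hA.top_mem).symm.lt_top⟩
    (hC.mono fun a ha => hA.subset ha.1) ⟨⊥, hA.bot_mem, (hne hA.bot_mem).symm.bot_lt⟩
    fun u hu v hv => ⟨v, hv.1, u, hu.1, hv.2.trans hu.2, le_rfl, le_rfl⟩
  refine ⟨q, hq, hc, fun a ha => ⟨fun haq => ?_, fun haq => ?_⟩⟩
  · refine hC.lt_of_not_le_of_mem (hA.subset ha) hc fun h => ?_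
    exact hqV a ⟨ha, h.lt_of_ne (hne ha)⟩ haq
  · refine hC.lt_of_not_le_of_mem hc (hA.subset ha) fun h => ?_
    exact haq (hqU a ⟨ha, h.lt_of_ne (hne ha).symm⟩)

/-- If the lower part of the cut of a saturated set `A` at a supported ultrafilter `q` has no
largest element, it is cofinal in the lower part of the cut of `C`. -/
theorem IsSaturated.cofinal_of_no_max (hC : IsChain (· ≤ ·) C) (hG : closure G = ⊤)
    (hA : IsSaturated C G A) (hq : SupportedOn G A q)
    (h : ∀ a ∈ A, a ∉ q.toPFilter → ∃ a' ∈ A, a' ∉ q.toPFilter ∧ a < a')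
    {c : B} (hc : c ∈ C) (hcq : c ∉ q.toPFilter) : ∃ a ∈ A, a ∉ q.toPFilter ∧ c ≤ a := by
  by_contra! hn
  -- If `c` lay above the whole lower part of `A`, a supported `y` could be placed directly above
  -- that part and contain `c`. It has the trace of `q` on `A`, so rigidity forces `y = q`, although
  -- `c ∉ q`.
  obtain ⟨y, hy, hyU, hyV⟩ := hA.exists_of_cut
    (U := {d ∈ C | ∀ a ∈ A, a ∉ q.toPFilter → a < d}) (V := {a ∈ A | a ∉ q.toPFilter})
    (hC.mono fun a ha => ha.1)
    ⟨c, hc, fun a ha haq => hC.lt_of_not_le_of_mem hc (hA.subset ha) (hn a ha haq)⟩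
    (hC.mono fun a ha => hA.subset ha.1) ⟨⊥, hA.bot_mem, q.bot_notMem⟩
    fun u hu v hv => by
      obtain ⟨a', ha', haq', hlt⟩ := h v hv.1 hv.2
      exact ⟨v, hv.1, a', ha', hlt, le_rfl, (hu.2 a' ha' haq').le⟩
  have : y = q := hy.eq_of_agree hG hq fun a ha =>
    ⟨fun hay => by_contra fun haq => hyV a ⟨ha, haq⟩ hay, fun haq => hyU a ⟨hA.subset ha,
      fun d hd hdq => hC.lt_of_mem_of_notMem_ult (hA.subset ha) (hA.subset hd) haq hdq⟩⟩
  subst this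
  exact hcq (hyU c ⟨hc, fun a ha haq => hC.lt_of_not_le_of_mem hc (hA.subset ha) (hn a ha haq)⟩)

/-- If the upper part of the cut of a saturated set `A` at a supported ultrafilter `q` has no
least element, it is coinitial in the upper part of the cut of `C`. -/
theorem IsSaturated.coinitial_of_no_min (hC : IsChain (· ≤ ·) C) (hG : closure G = ⊤)
    (hA : IsSaturated C G A) (hq : SupportedOn G A q)
    (h : ∀ a ∈ A, a ∈ q.toPFilter → ∃ a' ∈ A, a' ∈ q.toPFilter ∧ a' < a)
    {c : B} (hc : c ∈ C) (hcq : c ∈ q.toPFilter) : ∃ a ∈ A, a ∈ q.toPFilter ∧ a ≤ c := by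
  by_contra! hn
  obtain ⟨y, hy, hyU, hyV⟩ := hA.exists_of_cut
    (U := {a ∈ A | a ∈ q.toPFilter}) (V := {d ∈ C | ∀ a ∈ A, a ∈ q.toPFilter → d < a})
    (hC.mono fun a ha => hA.subset ha.1) ⟨⊤, hA.top_mem, q.top_mem⟩
    (hC.mono fun a ha => ha.1)
    ⟨c, hc, fun a ha haq => hC.lt_of_not_le_of_mem (hA.subset ha) hc (hn a ha haq)⟩
    fun u hu v hv => by
      obtain ⟨a', ha', haq', hlt⟩ := h u hu.1 hu.2
      exact ⟨a', ha', u, hu.1, hlt, (hv.2 a' ha' haq').le, le_rfl⟩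
  have : y = q := hy.eq_of_agree hG hq fun a ha =>
    ⟨fun hay => by_contra fun haq => hyV a ⟨hA.subset ha, fun d hd hdq =>
      hC.lt_of_mem_of_notMem_ult (hA.subset hd) (hA.subset ha) hdq haq⟩ hay,
      fun haq => hyU a ⟨ha, haq⟩⟩
  subst this
  exact hyV c ⟨hc, fun a ha haq => hC.lt_of_not_le_of_mem (hA.subset ha) hc (hn a ha haq)⟩ hcq

/-- On the ultrafilters supported on `A`, every element of `B` has the same trace as an element of
the subalgebra generated by `A`. -/
theorem exists_mem_closure_trace (hG : closure G = ⊤) (A : Set B) (b : B) :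
    ∃ b' : closure A, ∀ x : Ult B, SupportedOn G A x →
      (b ∈ x.toPFilter ↔ (b' : B) ∈ x.toPFilter) := by
  have hb : b ∈ closure G := by simp [hG]
  induction hb using closure_bot_sup_induction with
  | mem g hg =>
    by_cases hgA : g ∈ closure A
    · exact ⟨⟨g, hgA⟩, fun x _ => Iff.rfl⟩
    -- A generator outside `closure A` lies in no supported ultrafilter, so its trace is empty.
    · exact ⟨⟨⊥, bot_mem⟩, fun x hx => ⟨fun h => absurd (hx g hg h) hgA,
        fun h => absurd h x.bot_notMem⟩⟩
  | bot => exact ⟨⟨⊥, bot_mem⟩, fun x _ => Iff.rfl⟩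
  | sup x hx y hy ihx ihy =>
    obtain ⟨x', hx'⟩ := ihx
    obtain ⟨y', hy'⟩ := ihy
    exact ⟨⟨_, sup_mem x'.2 y'.2⟩, fun p hp => by
      rw [Ult.sup_mem_iff, Ult.sup_mem_iff, hx' p hp, hy' p hp]⟩
  | compl x hx ih =>
    obtain ⟨x', hx'⟩ := ih
    exact ⟨⟨_, compl_mem x'.2⟩, fun p hp => by
      rw [Ult.compl_mem_iff, Ult.compl_mem_iff, hx' p hp]⟩

/-- The ultrafilters supported on `A` whose cut of `A` is filled by some element of `C`. -/
def filledCuts (C G A : Set B) : Set (Ult B) :=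
  {q | SupportedOn G A q ∧ (gap C A q).Nonempty}

/-- If `a` separated the two cuts, then `c < a < c'`. Whichever side of `q` contains `c`, equality
of traces and upward closure give a contradiction. -/
theorem agree_of_trace_eq {c c' : B} (hq : SupportedOn G A q) (hq' : SupportedOn G A q') (hc : c ∈ gap C A q)
    (hc' : c' ∈ gap C A q')
    (htr : ∀ x : Ult B, SupportedOn G A x → (c ∈ x.toPFilter ↔ c' ∈ x.toPFilter))
    (hside : c ∈ q.toPFilter ↔ c' ∈ q'.toPFilter) {a : B} (ha : a ∈ A)
    (haq : a ∈ q.toPFilter) : a ∈ q'.toPFilter := by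
  by_contra hn
  have h1 := (hc.2 a ha).1 haq
  have h2 := (hc'.2 a ha).2 hn
  by_cases hcq : c ∈ q.toPFilter
  · exact hn (q'.mem_of_le h1.le ((htr q' hq').2 (hside.1 hcq)))
  · exact hcq ((htr q hq).2 (q.mem_of_le h2.le haq))

/-- A filled cut is encoded by the trace of one filler, an element of `closure A`, together with one
bit: whether the filler belongs to the ultrafilter. -/
theorem mk_filledCuts_le (hG : closure G = ⊤) {κ : Cardinal.{u}} (hκ : ℵ₀ ≤ κ) (hA : #A ≤ κ) :
    #(filledCuts C G A) ≤ κ := by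
  choose τ hτ using exists_mem_closure_trace hG A
  choose c hc using fun q : filledCuts C G A => q.2.2
  let f : filledCuts C G A → closure A × ULift.{u} Prop := fun q =>
    (τ (c q), ⟨c q ∈ q.1.toPFilter⟩)
  have hf : Function.Injective f := by
    intro q q' h
    have h1 : τ (c q) = τ (c q') := congrArg Prod.fst h
    have h2 : (c q ∈ q.1.toPFilter) = (c q' ∈ q'.1.toPFilter) :=
      congrArg (fun z => z.2.down) h
    have htr (x : Ult B) (hx : SupportedOn G A x) :
        c q ∈ x.toPFilter ↔ c q' ∈ x.toPFilter := by
      rw [hτ _ x hx, hτ (c q') x hx, h1]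
    refine Subtype.ext (q.2.1.eq_of_agree hG q'.2.1 fun a ha => ⟨?_, ?_⟩)
    · exact agree_of_trace_eq q.2.1 q'.2.1 (hc q) (hc q') htr h2.to_iff ha
    · exact agree_of_trace_eq q'.2.1 q.2.1 (hc q') (hc q) (fun x hx => (htr x hx).symm)
        h2.to_iff.symm ha
  refine (mk_le_of_injective hf).trans ?_
  rw [mk_prod, lift_id, lift_id]
  refine mul_le_of_le hκ (mk_closure_le hκ hA) ?_
  exact (lt_aleph0_of_finite _).le.trans hκ

end Chain

/-! ### Building saturated sets, and removing small ultrafilters from filled cuts. -/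

section Hull

variable {B : Type u} [BooleanAlgebra B] {C G A : Set B} {q : Ult B} {lam κ : Cardinal.{u}}

theorem exists_isSmall_between
    (hdense : ∀ b : B, b ≠ ⊥ → ∃ p : Ult B, IsSmall G lam p ∧ b ∈ p.toPFilter) {a b : B}
    (hab : a < b) : ∃ p : Ult B, IsSmall G lam p ∧ a ∉ p.toPFilter ∧ b ∈ p.toPFilter := by
  obtain ⟨p, hp, hbp⟩ := hdense (b ⊓ aᶜ) fun h =>
    hab.not_ge (disjoint_compl_right_iff.1 (disjoint_iff.2 h))
  exact ⟨p, hp, p.compl_mem_iff.1 (p.mem_of_le inf_le_right hbp), p.mem_of_le inf_le_left hbp⟩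

/-- For each `a < b`, a small ultrafilter between them has at most λ members of `G`; adding finite
supports in `C` for these makes it supported. The extra operation `f` serves later to keep one side
of a cut from having an extreme element. -/
theorem exists_isSaturated (hCtop : closure C = ⊤) (hbot : ⊥ ∈ C) (htop : ⊤ ∈ C)
    (hlam : ℵ₀ ≤ lam) (hdense : ∀ b : B, b ≠ ⊥ → ∃ p : Ult B, IsSmall G lam p ∧ b ∈ p.toPFilter)
    (hκ : lam ≤ κ) {f : B → B} (hf : ∀ c ∈ C, f c ∈ C) {S : Set B} (hSC : S ⊆ C) (hS : #S ≤ κ) :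
    ∃ A, S ⊆ A ∧ #A ≤ κ ∧ IsSaturated C G A ∧ ∀ a ∈ A, f a ∈ A := by
  have hκ₀ := hlam.trans hκ
  choose F hFC hF using fun b : B => exists_finset_mem_closure (S := C) (b := b) (by simp [hCtop])
  have hP (a b : B) : ∃ P : Set B, #P ≤ lam ∧ (a < b → ∃ p : Ult B, a ∉ p.toPFilter ∧
      b ∈ p.toPFilter ∧ ∀ g ∈ G, g ∈ p.toPFilter → g ∈ P) := by
    by_cases hab : a < b
    · obtain ⟨p, hp, hap, hbp⟩ := exists_isSmall_between hdense hab
      exact ⟨_, hp, fun _ => ⟨p, hap, hbp, fun g hg hgp => ⟨hg, hgp⟩⟩⟩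
    · exact ⟨∅, by simp, fun h => absurd h hab⟩
  choose P hPcard hP using hP
  obtain ⟨A, hSA, hA, hcl⟩ := exists_superset_closed hκ₀
    (fun a b : B => {f a} ∪ ⋃ g ∈ P a b, (F g : Set B))
    (fun a b => mk_union_le_of_le hκ₀ (mk_le_of_finite hκ₀ (by simp))
      (mk_biUnion_le_of_le hκ₀ ((hPcard a b).trans hκ)
        fun g _ => mk_le_of_finite hκ₀ (F g).finite_toSet)) (S := S ∪ {⊥, ⊤})
    (mk_union_le_of_le hκ₀ hS (mk_le_of_finite hκ₀ (by simp)))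
  -- Closing off need not stay inside `C`, but `f` and the supports `F g` do, so the intersection
  -- remains closed.
  refine ⟨A ∩ C, fun x hx => ⟨hSA (Or.inl hx), hSC hx⟩,
    (mk_le_mk_of_subset Set.inter_subset_left).trans hA,
    ⟨Set.inter_subset_right, ⟨hSA (by simp), hbot⟩, ⟨hSA (by simp), htop⟩, ?_⟩,
    fun a ha => ⟨hcl a ha.1 a ha.1 (Or.inl rfl), hf a ha.2⟩⟩
  intro a ha a' ha' hlt
  obtain ⟨p, hap, hap', hp⟩ := hP a a' hlt
  refine ⟨p, hap, hap', fun g hg hgp => closure_mono (fun x hx => ?_) (hF g)⟩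
  exact ⟨hcl a ha.1 a' ha'.1 (Or.inr (Set.mem_biUnion (hp g hg hgp) hx)), hFC g hx⟩

/-- A small ultrafilter has small character on both sides. -/
theorem IsSmall.exists_cofinal (hC : IsChain (· ≤ ·) C) (hCtop : closure C = ⊤) (hbot : ⊥ ∈ C)
    (htop : ⊤ ∈ C) (hG : closure G = ⊤) (hlam : ℵ₀ ≤ lam)
    (hdense : ∀ b : B, b ≠ ⊥ → ∃ p : Ult B, IsSmall G lam p ∧ b ∈ p.toPFilter)
    (hq : IsSmall G lam q) : ∃ T ⊆ C, #T ≤ lam ∧ ∀ A, T ⊆ A → gap C A q = ∅ := by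
  choose F hFC hF using fun b : B => exists_finset_mem_closure (S := C) (b := b) (by simp [hCtop])
  -- `f` moves an element of `C` strictly closer to the cut of `q` on its own side whenever
  -- possible, and fixes it otherwise.
  have hf (c : B) : ∃ d : B, (c ∈ C → d ∈ C) ∧
      (c ∉ q.toPFilter → (∃ e ∈ C, e ∉ q.toPFilter ∧ c < e) → d ∉ q.toPFilter ∧ c < d) ∧
      (c ∈ q.toPFilter → (∃ e ∈ C, e ∈ q.toPFilter ∧ e < c) → d ∈ q.toPFilter ∧ d < c) := by
    by_cases hc : c ∈ q.toPFilter
    · by_cases h : ∃ e ∈ C, e ∈ q.toPFilter ∧ e < c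
      · obtain ⟨e, heC, he⟩ := h
        exact ⟨e, fun _ => heC, fun h => absurd hc h, fun _ _ => he⟩
      · exact ⟨c, id, fun h => absurd hc h, fun _ h' => absurd h' h⟩
    · by_cases h : ∃ e ∈ C, e ∉ q.toPFilter ∧ c < e
      · obtain ⟨e, heC, he⟩ := h
        exact ⟨e, fun _ => heC, fun _ _ => he, fun h => absurd h hc⟩
      · exact ⟨c, id, fun _ h' => absurd h' h, fun h => absurd h hc⟩
  choose f hfC hfl hfu using hf
  -- `L` and `R` hold the elements of `C` adjacent to the cut, if any. On a side with none, `f`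
  -- makes `T` have no extreme element, so `T` is cofinal or coinitial there.
  let L : Set B := {c ∈ C | c ∉ q.toPFilter ∧ ∀ e ∈ C, e ∉ q.toPFilter → e ≤ c}
  let R : Set B := {c ∈ C | c ∈ q.toPFilter ∧ ∀ e ∈ C, e ∈ q.toPFilter → c ≤ e}
  have hL : L.Subsingleton := fun c hc d hd =>
    le_antisymm (hd.2.2 c hc.1 hc.2.1) (hc.2.2 d hd.1 hd.2.1)
  have hR : R.Subsingleton := fun c hc d hd =>
    le_antisymm (hc.2.2 d hd.1 hd.2.1) (hd.2.2 c hc.1 hc.2.1)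
  obtain ⟨T, hST, hT, hsat, hTf⟩ := exists_isSaturated hCtop hbot htop hlam hdense le_rfl hfC
    (S := (⋃ g ∈ G ∩ (q.toPFilter : Set B), (F g : Set B)) ∪ (L ∪ R))
    (Set.union_subset (Set.iUnion₂_subset fun g _ => hFC g)
      (Set.union_subset (fun c hc => hc.1) fun c hc => hc.1))
    (mk_union_le_of_le hlam (mk_biUnion_le_of_le hlam hq
      fun g _ => mk_le_of_finite hlam (F g).finite_toSet)
      (mk_le_of_finite hlam (hL.finite.union hR.finite)))
  have hqT : SupportedOn G T q := fun g hg hgq =>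
    closure_mono (fun x hx => hST (Or.inl (Set.mem_biUnion ⟨hg, hgq⟩ hx))) (hF g)
  refine ⟨T, hsat.subset, hT, fun A hTA => Set.eq_empty_of_forall_notMem fun c hc => ?_⟩
  by_cases hcq : c ∈ q.toPFilter
  · obtain ⟨t, ht, htq, htc⟩ : ∃ t ∈ T, t ∈ q.toPFilter ∧ t ≤ c := by
      by_cases hRne : R.Nonempty
      · obtain ⟨t, ht⟩ := hRne
        exact ⟨t, hST (Or.inr (Or.inr ht)), ht.2.1, ht.2.2 c hc.1 hcq⟩
      refine hsat.coinitial_of_no_min hC hG hqT (fun a ha haq => ?_) hc.1 hcq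
      refine ⟨f a, hTf a ha, hfu a haq ?_⟩
      by_contra! hn
      refine hRne ⟨a, hsat.subset ha, haq, fun e he heq => ?_⟩
      by_contra hle
      exact hn e he heq (hC.lt_of_not_le_of_mem (hsat.subset ha) he hle)
    exact (((hc.2 t (hTA ht)).1 htq).trans_le htc).false
  · obtain ⟨t, ht, htq, htc⟩ : ∃ t ∈ T, t ∉ q.toPFilter ∧ c ≤ t := by
      by_cases hLne : L.Nonempty
      · obtain ⟨t, ht⟩ := hLne
        exact ⟨t, hST (Or.inr (Or.inl ht)), ht.2.1, ht.2.2 c hc.1 hcq⟩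
      refine hsat.cofinal_of_no_max hC hG hqT (fun a ha haq => ?_) hc.1 hcq
      refine ⟨f a, hTf a ha, hfl a haq ?_⟩
      by_contra! hn
      refine hLne ⟨a, hsat.subset ha, haq, fun e he heq => ?_⟩
      by_contra hle
      exact hn e he heq (hC.lt_of_not_le_of_mem he (hsat.subset ha) hle)
    exact (((hc.2 t (hTA ht)).2 htq).trans_le htc).false

theorem isSaturated_iUnion {ι : Type*} [Nonempty ι] {A : ι → Set B} (hdir : Directed (· ⊆ ·) A)
    (hA : ∀ i, IsSaturated C G (A i)) : IsSaturated C G (⋃ i, A i) where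
  subset := Set.iUnion_subset fun i => (hA i).subset
  bot_mem := Set.mem_iUnion.2 ⟨Classical.arbitrary ι, (hA _).bot_mem⟩
  top_mem := Set.mem_iUnion.2 ⟨Classical.arbitrary ι, (hA _).top_mem⟩
  exists_supportedOn a ha a' ha' hlt := by
    obtain ⟨i, hi⟩ := Set.mem_iUnion.1 ha
    obtain ⟨j, hj⟩ := Set.mem_iUnion.1 ha'
    obtain ⟨k, hik, hjk⟩ := hdir i j
    obtain ⟨p, hp, hp', hps⟩ := (hA k).exists_supportedOn a (hik hi) a' (hjk hj) hlt
    exact ⟨p, hp, hp', hps.mono (Set.subset_iUnion A k)⟩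

theorem exists_mem_closure_of_directed {ι : Type*} [Nonempty ι] {A : ι → Set B}
    (hdir : Directed (· ⊆ ·) A) {b : B} (hb : b ∈ closure (⋃ i, A i)) :
    ∃ i, b ∈ closure (A i) := by
  obtain ⟨t, ht, hbt⟩ := exists_finset_mem_closure hb
  obtain ⟨i, hi⟩ := hdir.exists_mem_subset_of_finset_subset_biUnion ht
  exact ⟨i, closure_mono hi hbt⟩

theorem mk_Iio_succ_le (i : (Order.succ lam).ord.ToType) : #(Set.Iio i) ≤ lam := by
  have := mk_Iio_lt i (by simp)
  rw [mk_ord_toType] at this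
  exact Order.lt_succ_iff.1 this

/-- Regularity of λ⁺: at most λ initial segments, each of size at most λ, cannot cover it. -/
theorem exists_upper_bound_of_mk_le (hlam : ℵ₀ ≤ lam) {J : Type u} (hJ : #J ≤ lam)
    (h : J → (Order.succ lam).ord.ToType) : ∃ i, ∀ j, h j ≤ i := by
  by_contra! hn
  have hcov : (⋃ j, Set.Iio (h j)) = Set.univ := Set.eq_univ_of_forall fun i => by
    obtain ⟨j, hj⟩ := hn i
    exact Set.mem_iUnion.2 ⟨j, hj⟩
  have := mk_iUnion_le_of_le hlam hJ (f := fun j => Set.Iio (h j))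
    fun j => mk_Iio_succ_le _
  rw [hcov, mk_univ, mk_ord_toType] at this
  exact (Order.lt_succ lam).not_ge this

/-- Saturated sets all of whose filled cuts come from ultrafilters that are not small. -/
theorem exists_isSaturated_not_isSmall (hC : IsChain (· ≤ ·) C) (hCtop : closure C = ⊤)
    (hbot : ⊥ ∈ C) (htop : ⊤ ∈ C) (hG : closure G = ⊤) (hlam : ℵ₀ ≤ lam)
    (hdense : ∀ b : B, b ≠ ⊥ → ∃ p : Ult B, IsSmall G lam p ∧ b ∈ p.toPFilter)
    {S : Set B} (hSC : S ⊆ C) (hS : #S ≤ Order.succ lam) :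
    ∃ A, S ⊆ A ∧ #A ≤ Order.succ lam ∧ IsSaturated C G A ∧
      ∀ q ∈ filledCuts C G A, ¬ IsSmall G lam q := by
  have hle := Order.le_succ lam
  have hμ := hlam.trans hle
  have hH (S : Set B) : ∃ A, S ⊆ C → #S ≤ Order.succ lam →
      S ⊆ A ∧ #A ≤ Order.succ lam ∧ IsSaturated C G A := by
    by_cases h : S ⊆ C ∧ #S ≤ Order.succ lam
    · obtain ⟨A, h1, h2, h3, -⟩ := exists_isSaturated hCtop hbot htop hlam hdense hle
        (f := id) (fun _ h => h) h.1 h.2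
      exact ⟨A, fun _ _ => ⟨h1, h2, h3⟩⟩
    · exact ⟨∅, fun h1 h2 => absurd ⟨h1, h2⟩ h⟩
  choose H hH using hH
  have hT (q : Ult B) : ∃ T ⊆ C, #T ≤ lam ∧
      (IsSmall G lam q → ∀ A, T ⊆ A → gap C A q = ∅) := by
    by_cases hq : IsSmall G lam q
    · obtain ⟨T, h1, h2, h3⟩ := hq.exists_cofinal hC hCtop hbot htop hG hlam hdense
      exact ⟨T, h1, h2, fun _ => h3⟩
    · exact ⟨∅, by simp, by simp, fun h => absurd h hq⟩
  choose T hTC hTcard hT using hT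
  let ι := (Order.succ lam).ord.ToType
  -- `N` adds, for each small ultrafilter with a filled cut over the current stage, a set `T q` that
  -- empties its gap.
  let N : Set B → Set B := fun A => A ∪ ⋃ q ∈ filledCuts C G A, T q
  let A : ι → Set B := wellFounded_lt.fix fun i rec => H (S ∪ ⋃ j : Set.Iio i, N (rec j j.2))
  have hAeq (i : ι) : A i = H (S ∪ ⋃ j : Set.Iio i, N (A j)) := wellFounded_lt.fix_eq _ i
  have hA (i : ι) : (S ∪ ⋃ j : Set.Iio i, N (A j)) ⊆ A i ∧ #(A i) ≤ Order.succ lam ∧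
      IsSaturated C G (A i) := by
    induction i using WellFoundedLT.induction with
    | ind i ih =>
      have h := hH (S ∪ ⋃ j : Set.Iio i, N (A j))
        (Set.union_subset hSC (Set.iUnion_subset fun j => Set.union_subset (ih j j.2).2.2.subset
          (Set.iUnion₂_subset fun q _ => hTC q)))
        (mk_union_le_of_le hμ hS (mk_iUnion_le_of_le hμ ((mk_Iio_succ_le i).trans hle) fun j =>
          mk_union_le_of_le hμ (ih j j.2).2.1 ?_))
      · rw [← hAeq] at h
        exact h
      · have hcard := mk_filledCuts_le (C := C) hG hμ (ih j j.2).2.1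
        exact mk_biUnion_le_of_le hμ hcard fun q _ => (hTcard q).trans hle
  have hN {i j : ι} (hij : i < j) : N (A i) ⊆ A j := fun x hx =>
    (hA j).1 (Or.inr (Set.mem_iUnion.2 ⟨⟨i, hij⟩, hx⟩))
  have hmono : Monotone A := fun i j hij => by
    rcases hij.eq_or_lt with rfl | hlt
    · exact le_rfl
    · exact Set.subset_union_left.trans (hN hlt)
  have hdir : Directed (· ⊆ ·) A := hmono.directed_le
  have : NoMaxOrder ι := noMaxOrder hμ
  have : Nonempty ι := by
    rw [← mk_ne_zero_iff, mk_ord_toType]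
    exact (aleph0_pos.trans_le hμ).ne'
  refine ⟨⋃ i, A i, ?_, mk_iUnion_le_of_le hμ (mk_ord_toType _).le fun i => (hA i).2.1,
    isSaturated_iUnion hdir fun i => (hA i).2.2, ?_⟩
  · exact (Set.subset_union_left.trans (hA (Classical.arbitrary ι)).1).trans
      (Set.subset_iUnion A _)
  rintro q ⟨hq, hgap⟩ hsmall
  choose i hi using fun g : ↥(G ∩ (q.toPFilter : Set B)) =>
    exists_mem_closure_of_directed hdir (hq g g.2.1 g.2.2)
  -- A small `q` has at most λ members of `G`, so it is already supported on one stage `A k`; the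
  -- next stages then contain `T q`.
  obtain ⟨k, hk⟩ := exists_upper_bound_of_mk_le hlam hsmall i
  have hqk : q ∈ filledCuts C G (A k) :=
    ⟨fun g hg hgq => closure_mono (hmono (hk ⟨g, hg, hgq⟩)) (hi ⟨g, hg, hgq⟩),
      hgap.mono (gap_anti (Set.subset_iUnion A k))⟩
  obtain ⟨l, hl⟩ := exists_gt k
  refine hgap.ne_empty (hT q hsmall _ fun x hx => Set.mem_iUnion.2 ⟨l, hN hl (Or.inr ?_)⟩)
  exact Set.mem_biUnion hqk hx

end Hull

/-! ### Splitting large gaps. -/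

section Splitting

variable {B : Type u} [BooleanAlgebra B] {C G A : Set B} {q : Ult B} {lam κ : Cardinal.{u}}

/-- Pigeonhole: `Y \ A` is covered by at most κ nonempty gaps. -/
theorem IsSaturated.exists_large_gap (hC : IsChain (· ≤ ·) C) (hG : closure G = ⊤) (hκ : ℵ₀ ≤ κ)
    (hA : IsSaturated C G A) (hAκ : #A ≤ κ) {Y : Set B} (hY : Y ⊆ C) (hYκ : κ < #Y) :
    ∃ q : Ult B, SupportedOn G A q ∧ κ < #↥(Y ∩ gap C A q) := by
  by_contra! hn
  refine hYκ.not_ge ((mk_le_mk_of_subset (t := A ∪ ⋃ q ∈ filledCuts C G A, Y ∩ gap C A q)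
    fun y hy => ?_).trans (mk_union_le_of_le hκ hAκ
      (mk_biUnion_le_of_le hκ (mk_filledCuts_le hG hκ hAκ) fun q hq => hn q hq.1)))
  by_cases hyA : y ∈ A
  · exact Or.inl hyA
  · obtain ⟨q, hq, hyq⟩ := hA.exists_mem_gap hC (hY hy) hyA
    exact Or.inr (Set.mem_biUnion ⟨hq, y, hyq⟩ ⟨hy, hyq⟩)

/-- Otherwise the part of the gap below the cut has no maximum and all its initial segments have
size at most κ. A saturated set closed under moving up inside it is cofinal below the cut, so at
most κ of these segments cover that part. -/
theorem exists_split_lower (hC : IsChain (· ≤ ·) C) (hCtop : closure C = ⊤) (hbot : ⊥ ∈ C)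
    (htop : ⊤ ∈ C) (hG : closure G = ⊤) (hlam : ℵ₀ ≤ lam)
    (hdense : ∀ b : B, b ≠ ⊥ → ∃ p : Ult B, IsSmall G lam p ∧ b ∈ p.toPFilter)
    (hκ : lam ≤ κ) (hA : IsSaturated C G A) (hAκ : #A ≤ κ) (hq : SupportedOn G A q)
    (hbig : κ < #{x ∈ gap C A q | x ∉ q.toPFilter}) :
    ∃ c ∈ C, c ∉ q.toPFilter ∧ κ < #{x ∈ gap C A q | x ≤ c} := by
  have hκ₀ := hlam.trans hκ
  by_contra! hn
  have hf (c : B) : ∃ d : B, (c ∈ C → d ∈ C) ∧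
      (c ∈ gap C A q → c ∉ q.toPFilter → d ∉ q.toPFilter ∧ c < d) := by
    by_cases hc : c ∈ gap C A q ∧ c ∉ q.toPFilter
    · obtain ⟨d, hd, hcd⟩ : ∃ d ∈ {x ∈ gap C A q | x ∉ q.toPFilter}, ¬ d ≤ c := by
        by_contra! h
        exact hbig.not_ge (le_trans (mk_le_mk_of_subset fun x hx => And.intro hx.1 (h x hx))
          (hn c hc.1.1 hc.2))
      exact ⟨d, fun _ => hd.1.1, fun _ _ => ⟨hd.2, hC.lt_of_not_le_of_mem hd.1.1 hc.1.1 hcd⟩⟩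
    · exact ⟨c, id, fun h1 h2 => absurd ⟨h1, h2⟩ hc⟩
  choose f hfC hf using hf
  obtain ⟨⟨c₀, hc₀, hc₀q⟩⟩ := mk_ne_zero_iff.1 (bot_lt_iff_ne_bot.1 (bot_le.trans_lt hbig))
  obtain ⟨A', hAA', hA'κ, hA', hA'f⟩ := exists_isSaturated hCtop hbot htop hlam hdense hκ hfC
    (S := A ∪ {c₀}) (Set.union_subset hA.subset (by simpa using hc₀.1))
    (mk_union_le_of_le hκ₀ hAκ (mk_le_of_finite hκ₀ (by simp)))
  have hcof {c : B} (hc : c ∈ C) (hcq : c ∉ q.toPFilter) : ∃ a ∈ A', a ∉ q.toPFilter ∧ c ≤ a := by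
    refine hA'.cofinal_of_no_max hC hG (hq.mono (Set.subset_union_left.trans hAA'))
      (fun a ha haq => ?_) hc hcq
    · by_cases hag : a ∈ gap C A q
      · exact ⟨f a, hA'f a ha, hf a hag haq⟩
      -- An element below the cut of `q` but outside the gap lies below the whole gap, in particular
      -- below `c₀`.
      · refine ⟨c₀, hAA' (Or.inr rfl), hc₀q, ?_⟩
        by_contra hlt
        refine hag ⟨hA'.subset ha, fun d hd => ⟨fun hdq =>
          hC.lt_of_mem_of_notMem_ult (hA.subset hd) (hA'.subset ha) hdq haq, fun hdq => ?_⟩⟩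
        refine ((hc₀.2 d hd).2 hdq).trans_le ?_
        exact (hC.total hc₀.1 (hA'.subset ha)).resolve_right
          fun h => hlt (h.lt_of_ne fun h' => hag (h' ▸ hc₀))
  refine hbig.not_ge ((mk_le_mk_of_subset (t := ⋃ a ∈ {a ∈ A' | a ∉ q.toPFilter},
    {x ∈ gap C A q | x ≤ a}) fun x hx => ?_).trans (mk_biUnion_le_of_le hκ₀
      ((mk_le_mk_of_subset fun a ha => ha.1).trans hA'κ) fun a ha => hn a (hA'.subset ha.1) ha.2))
  obtain ⟨a, ha, haq, hxa⟩ := hcof hx.1.1 hx.2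
  exact Set.mem_biUnion (show a ∈ {a ∈ A' | a ∉ q.toPFilter} from ⟨ha, haq⟩) ⟨hx.1, hxa⟩

/-- The order dual of `exists_split_lower`. -/
theorem exists_split_upper (hC : IsChain (· ≤ ·) C) (hCtop : closure C = ⊤) (hbot : ⊥ ∈ C)
    (htop : ⊤ ∈ C) (hG : closure G = ⊤) (hlam : ℵ₀ ≤ lam)
    (hdense : ∀ b : B, b ≠ ⊥ → ∃ p : Ult B, IsSmall G lam p ∧ b ∈ p.toPFilter)
    (hκ : lam ≤ κ) (hA : IsSaturated C G A) (hAκ : #A ≤ κ) (hq : SupportedOn G A q)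
    (hbig : κ < #{x ∈ gap C A q | x ∈ q.toPFilter}) :
    ∃ c ∈ C, c ∈ q.toPFilter ∧ κ < #{x ∈ gap C A q | c ≤ x} := by
  have hκ₀ := hlam.trans hκ
  by_contra! hn
  have hf (c : B) : ∃ d : B, (c ∈ C → d ∈ C) ∧
      (c ∈ gap C A q → c ∈ q.toPFilter → d ∈ q.toPFilter ∧ d < c) := by
    by_cases hc : c ∈ gap C A q ∧ c ∈ q.toPFilter
    · obtain ⟨d, hd, hcd⟩ : ∃ d ∈ {x ∈ gap C A q | x ∈ q.toPFilter}, ¬ c ≤ d := by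
        by_contra! h
        exact hbig.not_ge (le_trans (mk_le_mk_of_subset fun x hx => And.intro hx.1 (h x hx))
          (hn c hc.1.1 hc.2))
      exact ⟨d, fun _ => hd.1.1, fun _ _ => ⟨hd.2, hC.lt_of_not_le_of_mem hc.1.1 hd.1.1 hcd⟩⟩
    · exact ⟨c, id, fun h1 h2 => absurd ⟨h1, h2⟩ hc⟩
  choose f hfC hf using hf
  obtain ⟨⟨c₀, hc₀, hc₀q⟩⟩ := mk_ne_zero_iff.1 (bot_lt_iff_ne_bot.1 (bot_le.trans_lt hbig))
  obtain ⟨A', hAA', hA'κ, hA', hA'f⟩ := exists_isSaturated hCtop hbot htop hlam hdense hκ hfC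
    (S := A ∪ {c₀}) (Set.union_subset hA.subset (by simpa using hc₀.1))
    (mk_union_le_of_le hκ₀ hAκ (mk_le_of_finite hκ₀ (by simp)))
  have hcof {c : B} (hc : c ∈ C) (hcq : c ∈ q.toPFilter) : ∃ a ∈ A', a ∈ q.toPFilter ∧ a ≤ c := by
    refine hA'.coinitial_of_no_min hC hG (hq.mono (Set.subset_union_left.trans hAA'))
      (fun a ha haq => ?_) hc hcq
    · by_cases hag : a ∈ gap C A q
      · exact ⟨f a, hA'f a ha, hf a hag haq⟩
      · refine ⟨c₀, hAA' (Or.inr rfl), hc₀q, ?_⟩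
        by_contra hlt
        refine hag ⟨hA'.subset ha, fun d hd => ⟨fun hdq => ?_, fun hdq =>
          hC.lt_of_mem_of_notMem_ult (hA'.subset ha) (hA.subset hd) haq hdq⟩⟩
        refine lt_of_le_of_lt ?_ ((hc₀.2 d hd).1 hdq)
        exact (hC.total hc₀.1 (hA'.subset ha)).resolve_left
          fun h => hlt (h.lt_of_ne fun h' => hag (h' ▸ hc₀))
  refine hbig.not_ge ((mk_le_mk_of_subset (t := ⋃ a ∈ {a ∈ A' | a ∈ q.toPFilter},
    {x ∈ gap C A q | a ≤ x}) fun x hx => ?_).trans (mk_biUnion_le_of_le hκ₀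
      ((mk_le_mk_of_subset fun a ha => ha.1).trans hA'κ) fun a ha => hn a (hA'.subset ha.1) ha.2))
  obtain ⟨a, ha, haq, hxa⟩ := hcof hx.1.1 hx.2
  exact Set.mem_biUnion (show a ∈ {a ∈ A' | a ∈ q.toPFilter} from ⟨ha, haq⟩) ⟨hx.1, hxa⟩

/-- Inside a large gap one finds, over a larger saturated set, a large gap at another
ultrafilter. -/
theorem exists_next_large_gap (hC : IsChain (· ≤ ·) C) (hCtop : closure C = ⊤) (hbot : ⊥ ∈ C)
    (htop : ⊤ ∈ C) (hG : closure G = ⊤) (hlam : ℵ₀ ≤ lam)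
    (hdense : ∀ b : B, b ≠ ⊥ → ∃ p : Ult B, IsSmall G lam p ∧ b ∈ p.toPFilter)
    (hκ : lam ≤ κ) (hA : IsSaturated C G A) (hAκ : #A ≤ κ) (hq : SupportedOn G A q)
    (hbig : κ < #(gap C A q)) :
    ∃ A' q', IsSaturated C G A' ∧ #A' ≤ κ ∧ SupportedOn G A' q' ∧ κ < #(gap C A' q') ∧
      q ≠ q' ∧ ∀ a ∈ A, a ∈ q.toPFilter ↔ a ∈ q'.toPFilter := by
  have hκ₀ := hlam.trans hκ
  -- Putting `c` into `A'` makes it distinguish `q` from any ultrafilter whose gap meets `Y`, since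
  -- `Y` lies on the side of `c` away from the cut of `q`.
  have key {c : B} (hc : c ∈ C) {Y : Set B} (hY : Y ⊆ gap C A q) (hYκ : κ < #Y)
      (hne : ∀ y ∈ Y, ∀ A' q', c ∈ A' → y ∈ gap C A' q' → q ≠ q') :
      ∃ A' q', IsSaturated C G A' ∧ #A' ≤ κ ∧ SupportedOn G A' q' ∧ κ < #(gap C A' q') ∧
        q ≠ q' ∧ ∀ a ∈ A, a ∈ q.toPFilter ↔ a ∈ q'.toPFilter := by
    obtain ⟨A', hAA', hA'κ, hA', -⟩ := exists_isSaturated hCtop hbot htop hlam hdense hκ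
      (f := id) (fun _ h => h) (S := A ∪ {c}) (Set.union_subset hA.subset (by simpa using hc))
      (mk_union_le_of_le hκ₀ hAκ (mk_le_of_finite hκ₀ (by simp)))
    obtain ⟨q', hq', hbig'⟩ := hA'.exists_large_gap hC hG hκ₀ hA'κ (fun y hy => (hY hy).1) hYκ
    obtain ⟨⟨y, hyY, hyg⟩⟩ := mk_ne_zero_iff.1 (bot_lt_iff_ne_bot.1 (bot_le.trans_lt hbig'))
    exact ⟨A', q', hA', hA'κ, hq', hbig'.trans_le (mk_le_mk_of_subset Set.inter_subset_right),
      hne y hyY A' q' (hAA' (Or.inr rfl)) hyg,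
      agree_of_mem_gap (Set.subset_union_left.trans hAA') (hY hyY) hyg⟩
  have hsplit : κ < #{x ∈ gap C A q | x ∉ q.toPFilter} ∨
      κ < #{x ∈ gap C A q | x ∈ q.toPFilter} := by
    by_contra! hn
    refine hbig.not_ge ((mk_le_mk_of_subset fun x hx => ?_).trans
      (mk_union_le_of_le hκ₀ hn.1 hn.2))
    by_cases hxq : x ∈ q.toPFilter
    · exact Or.inr ⟨hx, hxq⟩
    · exact Or.inl ⟨hx, hxq⟩
  rcases hsplit with h | h
  · obtain ⟨c, hc, hcq, hcbig⟩ :=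
      exists_split_lower hC hCtop hbot htop hG hlam hdense hκ hA hAκ hq h
    refine key hc (fun x hx => hx.1) hcbig fun y hy A' q' hcA' hyg heq => ?_
    exact (((hyg.2 c hcA').2 (heq ▸ hcq)).trans_le hy.2).false
  · obtain ⟨c, hc, hcq, hcbig⟩ :=
      exists_split_upper hC hCtop hbot htop hG hlam hdense hκ hA hAκ hq h
    refine key hc (fun x hx => hx.1) hcbig fun y hy A' q' hcA' hyg heq => ?_
    exact (((hyg.2 c hcA').1 (heq ▸ hcq)).trans_le hy.2).false

end Splitting

/-! ### Limits of sequences of ultrafilters. -/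

section Limit

variable {B : Type u} [BooleanAlgebra B] {C G : Set B} {lam : Cardinal.{u}}

/-- Each element of the limit lies in some `p k`, so its members of `G` form a subset of a countable
union of sets of size at most λ. -/
theorem isSmall_lim (hlam : ℵ₀ ≤ lam) (F : Ultrafilter ℕ) {p : ℕ → Ult B}
    (hp : ∀ k, IsSmall G lam (p k)) : IsSmall G lam (Ult.lim F p) := by
  refine (mk_le_mk_of_subset (t := ⋃ k : ULift.{u} ℕ, G ∩ ((p k.down).toPFilter : Set B))
    fun g hg => ?_).trans (mk_iUnion_le_of_le hlam (by simpa using hlam) fun k => hp k.down)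
  obtain ⟨k, hk⟩ := (Ult.mem_lim.1 hg.2).exists
  exact Set.mem_iUnion.2 ⟨⟨k⟩, hg.1, hk⟩

theorem eventually_ge_hyperfilter (j : ℕ) :
    ∀ᶠ k in (Filter.hyperfilter ℕ : Filter ℕ), j ≤ k :=
  Filter.hyperfilter_le_cofinite (Nat.cofinite_eq_atTop ▸ Filter.eventually_ge_atTop j)

/-- The limit of a sequence of ultrafilters whose cuts strictly increase is small. -/
theorem isSmall_lim_of_increasing (hC : IsChain (· ≤ ·) C) (hCtop : closure C = ⊤)
    (hlam : ℵ₀ ≤ lam)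
    (hdense : ∀ b : B, b ≠ ⊥ → ∃ p : Ult B, IsSmall G lam p ∧ b ∈ p.toPFilter) {x : ℕ → Ult B}
    (hx : ∀ m n, m < n → ∃ c ∈ C, c ∈ (x n).toPFilter ∧ c ∉ (x m).toPFilter) :
    IsSmall G lam (Ult.lim (Filter.hyperfilter ℕ) x) := by
  have hmono {m n : ℕ} (hmn : m ≤ n) {d : B} (hd : d ∈ C) (hdm : d ∈ (x m).toPFilter) :
      d ∈ (x n).toPFilter := by
    rcases hmn.eq_or_lt with rfl | hlt
    · exact hdm
    · obtain ⟨c, hc, hcn, hcm⟩ := hx m n hlt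
      exact (x n).mem_of_le (hC.lt_of_mem_of_notMem_ult hd hc hdm hcm).le hcn
  choose c hcC hc hc' using fun k : ℕ => hx k (k + 1) k.lt_succ_self
  -- Here `c (k + 1) < c k`, and on `C` the trace of `p k` lies between those of `x k` and `x (k +
  -- 2)`. Hence both sequences have the same limit.
  choose p hp hpl hpu using fun k : ℕ => exists_isSmall_between hdense
    (hC.lt_of_mem_of_notMem_ult (hcC k) (hcC (k + 1)) (hc k) (hc' (k + 1)))
  have : Ult.lim (Filter.hyperfilter ℕ) x = Ult.lim (Filter.hyperfilter ℕ) p := by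
    refine Ult.eq_of_closure_eq_top hCtop fun d hd => ⟨fun h => ?_, fun h => ?_⟩
    · exact (Ult.mem_lim.1 h).mono fun k hk =>
        (p k).mem_of_le (hC.lt_of_mem_of_notMem_ult hd (hcC k) hk (hc' k)).le (hpu k)
    · obtain ⟨k, hk⟩ := (Ult.mem_lim.1 h).exists
      refine (eventually_ge_hyperfilter (k + 2)).mono fun l hl => hmono hl hd ?_
      exact (x (k + 2)).mem_of_le
        (hC.lt_of_mem_of_notMem_ult hd (hcC (k + 1)) hk (hpl k)).le (hc (k + 1))
  rw [this]
  exact isSmall_lim hlam _ hp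

/-- The limit of a sequence of ultrafilters whose cuts strictly decrease is small. -/
theorem isSmall_lim_of_decreasing (hC : IsChain (· ≤ ·) C) (hCtop : closure C = ⊤)
    (hlam : ℵ₀ ≤ lam)
    (hdense : ∀ b : B, b ≠ ⊥ → ∃ p : Ult B, IsSmall G lam p ∧ b ∈ p.toPFilter) {x : ℕ → Ult B}
    (hx : ∀ m n, m < n → ∃ c ∈ C, c ∈ (x m).toPFilter ∧ c ∉ (x n).toPFilter) :
    IsSmall G lam (Ult.lim (Filter.hyperfilter ℕ) x) := by
  have hanti {m n : ℕ} (hmn : m ≤ n) {d : B} (hd : d ∈ C) (hdn : d ∈ (x n).toPFilter) :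
      d ∈ (x m).toPFilter := by
    rcases hmn.eq_or_lt with rfl | hlt
    · exact hdn
    · obtain ⟨c, hc, hcm, hcn⟩ := hx m n hlt
      exact (x m).mem_of_le (hC.lt_of_mem_of_notMem_ult hd hc hdn hcn).le hcm
  choose c hcC hc hc' using fun k : ℕ => hx k (k + 1) k.lt_succ_self
  choose p hp hpl hpu using fun k : ℕ => exists_isSmall_between hdense
    (hC.lt_of_mem_of_notMem_ult (hcC (k + 1)) (hcC k) (hc (k + 1)) (hc' k))
  have : Ult.lim (Filter.hyperfilter ℕ) x = Ult.lim (Filter.hyperfilter ℕ) p := by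
    refine Ult.eq_of_closure_eq_top hCtop fun d hd => ⟨fun h => ?_, fun h => ?_⟩
    · refine Filter.Eventually.of_forall fun k => ?_
      obtain ⟨l, hl, hdl⟩ := ((eventually_ge_hyperfilter (k + 2)).and (Ult.mem_lim.1 h)).exists
      exact (p k).mem_of_le (hC.lt_of_mem_of_notMem_ult hd (hcC (k + 1)) (hanti hl hd hdl)
        (hc' (k + 1))).le (hpu k)
    · exact (Ult.mem_lim.1 h).mono fun k hk =>
        (x k).mem_of_le (hC.lt_of_mem_of_notMem_ult hd (hcC k) hk (hpl k)).le (hc k)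
  rw [this]
  exact isSmall_lim hlam _ hp

/-- If the traces on `G` of a sequence of ultrafilters strictly increase, the first one is
small. -/
theorem isSmall_of_strictly_increasing_trace (hC : IsChain (· ≤ ·) C) (hCtop : closure C = ⊤)
    (hG : closure G = ⊤) (hlam : ℵ₀ ≤ lam)
    (hdense : ∀ b : B, b ≠ ⊥ → ∃ p : Ult B, IsSmall G lam p ∧ b ∈ p.toPFilter) {x : ℕ → Ult B}
    (hx : ∀ n, ∀ g ∈ G, g ∈ (x n).toPFilter → g ∈ (x (n + 1)).toPFilter)
    (hne : ∀ n, x n ≠ x (n + 1)) : IsSmall G lam (x 0) := by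
  have hmono {m n : ℕ} (hmn : m ≤ n) {g : B} (hg : g ∈ G) (hgm : g ∈ (x m).toPFilter) :
      g ∈ (x n).toPFilter := by
    induction n, hmn using Nat.le_induction with
    | base => exact hgm
    | succ n _ ih => exact hx n g hg ih
  have hne' {m n : ℕ} (hmn : m < n) : x m ≠ x n := fun h =>
    hne m (Ult.eq_of_closure_eq_top hG fun g hg =>
      ⟨hx m g hg, fun hg' => h ▸ hmono (Nat.succ_le_of_lt hmn) hg hg'⟩)
  -- Traces on `G` increase, so the limit of any subsequence contains `G ∩ x 0`.
  have hbound (φ : ℕ → ℕ) (h : IsSmall G lam (Ult.lim (Filter.hyperfilter ℕ) (x ∘ φ))) :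
      IsSmall G lam (x 0) :=
    le_trans (mk_le_mk_of_subset fun g hg => And.intro hg.1
      (Filter.Eventually.of_forall fun k => hmono (Nat.zero_le _) hg.1 hg.2)) h
  let r : Ult B → Ult B → Prop := fun y z => ∃ c ∈ C, c ∈ z.toPFilter ∧ c ∉ y.toPFilter
  have : IsTrans (Ult B) r := ⟨by
    rintro y z w ⟨c, hc, hcz, hcy⟩ ⟨d, hd, hdw, hdz⟩
    exact ⟨d, hd, hdw, fun hdy =>
      hcy (y.mem_of_le (hC.lt_of_mem_of_notMem_ult hc hd hcz hdz).le hdy)⟩⟩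
  -- Ramsey for the order of cuts. In the second alternative distinctness of the terms makes the
  -- decrease strict.
  obtain ⟨φ, hφ | hφ⟩ := exists_increasing_or_nonincreasing_subseq r x
  · exact hbound φ (isSmall_lim_of_increasing hC hCtop hlam hdense hφ)
  · refine hbound φ (isSmall_lim_of_decreasing hC hCtop hlam hdense fun m n hmn => ?_)
    by_contra! hn
    refine hne' (φ.strictMono hmn) (Ult.eq_of_closure_eq_top hCtop fun c hc => ⟨hn c hc, ?_⟩)
    intro hcn
    by_contra hcm
    exact hφ m n hmn ⟨c, hc, hcn, hcm⟩

end Limit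

/-! ### Conclusion: the cardinal bound and the theorem. -/

/-- In a Boolean algebra generated by a chain, if the ultrafilters containing at most `lam` members
of a generating set are dense, then the algebra has at most `lam⁺` elements. -/
theorem mk_le_succ_of_dense_isSmall {B : Type u} [BooleanAlgebra B] {C G : Set B}
    {lam : Cardinal.{u}} (hC : IsChain (· ≤ ·) C) (hCtop : closure C = ⊤) (hbot : ⊥ ∈ C)
    (htop : ⊤ ∈ C) (hG : closure G = ⊤) (hlam : ℵ₀ ≤ lam)
    (hdense : ∀ b : B, b ≠ ⊥ → ∃ p : Ult B, IsSmall G lam p ∧ b ∈ p.toPFilter) :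
    #B ≤ Order.succ lam := by
  have hle := Order.le_succ lam
  have hμ := hlam.trans hle
  by_contra! hcard
  have hCcard : Order.succ lam < #C := by
    by_contra! h
    refine hcard.not_ge ?_
    have := mk_closure_le hμ h
    rw [hCtop] at this
    exact (mk_le_of_injective topEquiv.symm.injective).trans this
  obtain ⟨A₀, -, hA₀μ, hA₀, hA₀s⟩ := exists_isSaturated_not_isSmall hC hCtop hbot htop hG hlam
    hdense (S := ∅) (Set.empty_subset _) (by simp)
  obtain ⟨q₀, hq₀, hbig₀⟩ := hA₀.exists_large_gap hC hG hμ hA₀μ subset_rfl hCcard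
  replace hbig₀ := hbig₀.trans_le (mk_le_mk_of_subset Set.inter_subset_right)
  -- The data preserved by splitting. Only `A₀` needs the stronger property that its filled cuts are
  -- not small.
  let State := {s : Set B × Ult B // IsSaturated C G s.1 ∧ #s.1 ≤ Order.succ lam ∧
    SupportedOn G s.1 s.2 ∧ Order.succ lam < #(gap C s.1 s.2)}
  have hnext (s : State) : ∃ s' : State, s.1.2 ≠ s'.1.2 ∧
      ∀ a ∈ s.1.1, a ∈ s.1.2.toPFilter ↔ a ∈ s'.1.2.toPFilter := by
    obtain ⟨⟨A, q⟩, hA, hAμ, hq, hbig⟩ := s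
    obtain ⟨A', q', h1, h2, h3, h4, h5, h6⟩ :=
      exists_next_large_gap hC hCtop hbot htop hG hlam hdense hle hA hAμ hq hbig
    exact ⟨⟨(A', q'), h1, h2, h3, h4⟩, h5, h6⟩
  choose next hne hagree using hnext
  let s : ℕ → State := fun n => next^[n] ⟨(A₀, q₀), hA₀, hA₀μ, hq₀, hbig₀⟩
  have hs (n : ℕ) : s (n + 1) = next (s n) := Function.iterate_succ_apply' _ _ _
  have hgap : (gap C A₀ q₀).Nonempty := by
    obtain ⟨⟨y, hy⟩⟩ := mk_ne_zero_iff.1 (bot_lt_iff_ne_bot.1 (bot_le.trans_lt hbig₀))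
    exact ⟨y, hy⟩
  refine hA₀s q₀ ⟨hq₀, hgap⟩ (isSmall_of_strictly_increasing_trace hC hCtop hG hlam hdense
    (x := fun n => (s n).1.2) (fun n g hg hgn => ?_) fun n => ?_)
  · simp only [hs]
    exact (s n).2.2.2.1.mem_of_agree (hagree (s n)) hg hgn
  · simp only [hs]
    exact hne (s n)

/-- An interval Boolean algebra is generated by a chain that contains both bounds. -/
theorem IsIntervalBooleanAlgebra.exists_chain {B : Type u} [BooleanAlgebra B]
    (hB : IsIntervalBooleanAlgebra B) :
    ∃ C : Set B, IsChain (· ≤ ·) C ∧ closure C = ⊤ ∧ ⊥ ∈ C ∧ ⊤ ∈ C := by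
  obtain ⟨L, _, ⟨e⟩⟩ := hB
  let c : L → B := fun a => e.symm ⟨Set.Ici a, subset_closure ⟨a, rfl⟩⟩
  have hc : IsChain (· ≤ ·) (Set.range c) := by
    rintro _ ⟨a, rfl⟩ _ ⟨b, rfl⟩ -
    rcases le_total a b with h | h
    · exact Or.inr (e.symm.monotone (Set.Ici_subset_Ici.2 h))
    · exact Or.inl (e.symm.monotone (Set.Ici_subset_Ici.2 h))
  refine ⟨insert ⊥ (insert ⊤ (Set.range c)), ?_, ?_, by simp, by simp⟩
  · exact (hc.insert fun b _ _ => Or.inr le_top).insert fun b _ _ => Or.inl bot_le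
  · refine top_unique fun b _ => closure_mono (s := Set.range c) (by grind) ?_
    have key (x : Set L) (hx : x ∈ intervalAlgebra L) :
        e.symm ⟨x, hx⟩ ∈ closure (Set.range c) := by
      induction hx using closure_bot_sup_induction with
      | mem x hx =>
        obtain ⟨a, rfl⟩ := hx
        exact subset_closure ⟨a, rfl⟩
      | bot => exact (map_bot e.symm) ▸ bot_mem
      | sup x hx y hy ihx ihy =>
        have h := e.symm.map_sup (⟨x, hx⟩ : intervalAlgebra L) ⟨y, hy⟩
        exact h ▸ sup_mem ihx ihy
      | compl x hx ih =>
        have h := map_compl' e.symm (⟨x, hx⟩ : intervalAlgebra L)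
        exact h ▸ compl_mem ih
    simpa using key (e b).1 (e b).2

theorem mainTheorem9 {B : Type u} [BooleanAlgebra B] (hB : IsIntervalBooleanAlgebra B)
    (lam : Cardinal.{u}) (hlam : Cardinal.aleph0 ≤ lam) (hcard : Order.succ lam < Cardinal.mk B)
    (G : Set B) (hG : BooleanSubalgebra.closure G = ⊤)
    (D : Set (Ult B)) (hD : Dense D) :
    ∃ p ∈ D, lam < Cardinal.mk ↥(G ∩ (p.toPFilter : Set B)) := by
  by_contra! hsmall
  obtain ⟨C, hC, hCtop, hbot, htop⟩ := hB.exists_chain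
  refine hcard.not_ge (mk_le_succ_of_dense_isSmall hC hCtop hbot htop hG hlam fun b hb => ?_)
  obtain ⟨p, hpb, hpD⟩ := hD.inter_open_nonempty {p : Ult B | b ∈ p.toPFilter}
    (.basic _ ⟨b, rfl⟩) (Ult.exists_mem_of_ne_bot hb)
  exact ⟨p, hsmall p hpD, hpb⟩
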